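/- Theorem (routing in $G_9$ and $G_{12}$). Let $P$ be a finite set of $n$ points in the plane, no two of which lie on a line parallel to a direction $k\pi/3$ ($k\in\mathbb{Z}$). For $u\in P$ divide the plane around $u$ into six cones by the rays from $u$ at angles $k\pi/3$, and call them, counter-clockwise from the positive $x$-axis, $\overline C_1,C_0,\overline C_2,C_1,\overline C_0,C_2$; the cones $C_i$ are positive, the cones $\overline C_i$ negative. The half-$\theta_6$-graph of $P$ joins each $u\in P$, in each of its positive cones that contains a point of $P$, to the closest vertex in that cone; "closest" always means that the projection on the bisector of the cone is closest to $u$. The graph $G_{12}$ keeps, of the edges of the half-$\theta_6$-graph from $u$ into each negative cone of $u$, only the first and the last in clockwise order around $u$ and the one to the closest neighbour. The graph $G_9$ consists of the edges to the closest neighbour in each negative cone of each vertex and of the edges between clockwise consecutive neighbours (in the half-$\theta_6$-graph) of a vertex within one of its negative cones. A unit of memory holds an integer in $\{0,\dots,n-1\}$ or a point of $P$. In a deterministic $1$-local $m$-memory routing algorithm with information stored at the vertices, the vertex to which a message is forwarded and its new memory of at most $m$ units are a function of the current vertex $s$, the destination $t$, the set consisting of $s$ and its neighbours, the information stored at $s$,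 and the present memory of the message, which is empty at the start; the message is always forwarded to a neighbour of $s$. There are a constant $m$ and one such routing algorithm, both independent of $P$, such that for every $P$ as above one can store at most $m$ units of information at each vertex so that, on $G_9$ as well as on $G_{12}$, for all $s,t \in P$ the message from $s$ reaches $t$ after travelling a total distance of at most 1. $6\,|st|$ if $t$ lies in a positive cone of $s$, 2. $3\cdot\frac{5}{\sqrt3}\,|st|\approx 8.660\,|st|$ if $t$ lies in a negative cone of $s$. -/

import Mathlib

noncomputable section

/-! ### Cones in the plane -/

/-- The Euclidean plane. -/
abbrev Plane : Type := EuclideanSpace ℝ (Fin 2)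

/-- Unit vector in the direction that makes the angle `θ` with the positive `x`-axis. -/
def dir (θ : ℝ) : Plane := !₂[Real.cos θ, Real.sin θ]

/-- The direction of the `k`-th cone boundary ray: angle `k * π / 3`. -/
def ray (k : ℕ) : Plane := dir (k * (Real.pi / 3))

/-- The open cone with apex `u` between the rays at angles `k * π / 3` and `(k + 1) * π / 3`. -/
def sector (k : ℕ) (u : Plane) : Set Plane :=
  {v | ∃ a b : ℝ, 0 < a ∧ 0 < b ∧ v = u + a • ray k + b • ray (k + 1)}

/-- Signed length of the projection of `v - u` on the bisector of the `k`-th cone of `u`. -/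
def bisectorProj (k : ℕ) (u v : Plane) : ℝ :=
  inner ℝ (dir ((2 * k + 1) * (Real.pi / 6))) (v - u)

/-- The number of the sector that is the positive cone `C i`: counter-clockwise from the
positive `x`-axis the six cones are `C̄ 1, C 0, C̄ 2, C 1, C̄ 0, C 2`. -/
def posIndex (i : Fin 3) : ℕ := 2 * i + 1

/-- The number (modulo 6) of the sector that is the negative cone `C̄ i`, opposite to `C i`. -/
def negIndex (i : Fin 3) : ℕ := 2 * i + 4

/-- The positive cone `C i` with apex `u`. -/
def posCone (i : Fin 3) (u : Plane) : Set Plane := sector (posIndex i) u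

/-- The negative cone `C̄ i` with apex `u`. -/
def negCone (i : Fin 3) (u : Plane) : Set Plane := sector (negIndex i) u

/-- No two points of `P` lie on a line parallel to a cone boundary. -/
def GeneralPosition (P : Finset Plane) : Prop :=
  ∀ u ∈ P, ∀ v ∈ P, u ≠ v → ∀ (k : ℕ) (c : ℝ), v - u ≠ c • ray k

/-! ### The half-θ₆-graph and its bounded degree subgraphs -/

/-- `v` is the closest vertex of `P` in the positive cone `C i` of `u`, where distances are
measured along the bisector of the cone. -/
def IsClosestPos (P : Finset Plane) (i : Fin 3) (u v : P) : Prop :=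
  (v : Plane) ∈ posCone i u ∧
    ∀ w : P, (w : Plane) ∈ posCone i u →
      bisectorProj (posIndex i) u v ≤ bisectorProj (posIndex i) u w

/-- The half-θ₆-graph of `P`: every vertex is joined to the closest vertex in each of its
positive cones. -/
def halfTheta6 (P : Finset Plane) : SimpleGraph P :=
  SimpleGraph.fromRel fun u v => ∃ i, IsClosestPos P i u v

/-- The neighbours of `u` in the half-θ₆-graph that lie in the negative cone `C̄ i` of `u`. -/
def negNbrs (P : Finset Plane) (i : Fin 3) (u : P) : Set P :=
  {v | (halfTheta6 P).Adj u v ∧ (v : Plane) ∈ negCone i u}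

/-- For `v`, `w` in a common cone of `u`: `w` comes strictly after `v` in clockwise order
around `u`. -/
def ClockwiseLT (u v w : Plane) : Prop :=
  (v - u) 0 * (w - u) 1 - (v - u) 1 * (w - u) 0 < 0

/-- `v` is the neighbour of `u` in the negative cone `C̄ i` that is closest along the bisector. -/
def IsClosestNeg (P : Finset Plane) (i : Fin 3) (u v : P) : Prop :=
  v ∈ negNbrs P i u ∧
    ∀ w ∈ negNbrs P i u, bisectorProj (negIndex i) u v ≤ bisectorProj (negIndex i) u w

/-- `v` is the first neighbour of `u` in the negative cone `C̄ i`, in clockwise order. -/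
def IsFirstNeg (P : Finset Plane) (i : Fin 3) (u v : P) : Prop :=
  v ∈ negNbrs P i u ∧ ∀ w ∈ negNbrs P i u, w ≠ v → ClockwiseLT u v w

/-- `v` is the last neighbour of `u` in the negative cone `C̄ i`, in clockwise order. -/
def IsLastNeg (P : Finset Plane) (i : Fin 3) (u v : P) : Prop :=
  v ∈ negNbrs P i u ∧ ∀ w ∈ negNbrs P i u, w ≠ v → ClockwiseLT u w v

/-- `v` and `w` are consecutive neighbours of `u` (in this clockwise order) in the negative
cone `C̄ i`, so that `v w` is an edge of the canonical path of `u` in this cone. -/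
def IsConsecutiveNeg (P : Finset Plane) (i : Fin 3) (u v w : P) : Prop :=
  v ∈ negNbrs P i u ∧ w ∈ negNbrs P i u ∧ ClockwiseLT u v w ∧
    ∀ x ∈ negNbrs P i u, ¬ (ClockwiseLT u v x ∧ ClockwiseLT u x w)

/-- `G₁₂`: of the edges in each negative cone, only the first, the last and the closest are
kept. -/
def G12 (P : Finset Plane) : SimpleGraph P :=
  SimpleGraph.fromRel fun u v =>
    ∃ i, IsFirstNeg P i u v ∨ IsLastNeg P i u v ∨ IsClosestNeg P i u v

/-- `G₉`: the edges of the half-θ₆-graph that are the closest edge in some negative cone or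
belong to the canonical path of some negative cone. -/
def G9 (P : Finset Plane) : SimpleGraph P :=
  SimpleGraph.fromRel fun v w =>
    (halfTheta6 P).Adj v w ∧
      ((∃ i, IsClosestNeg P i v w) ∨ ∃ i u, IsConsecutiveNeg P i u v w)

/-! ### Local routing with memory -/

/-- The content of a unit of memory: an integer or a point. -/
inductive MemCell : Type
  | int (k : ℕ)
  | pt (p : Plane)

/-- The contents allowed when the vertex set is `P`, with `n` elements: an integer of `log₂ n`
bits, or a vertex. (Points outside `P` are not allowed: arbitrary real coordinates could encode
the whole graph in a single unit.) -/
def MemCell.Valid (P : Finset Plane) : MemCell → Prop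
  | .int k => k < P.card
  | .pt p => p ∈ P

/-- The list `M` of memory contents takes at most `m` units of memory. -/
def FitsMemory (P : Finset Plane) (m : ℕ) (M : List MemCell) : Prop :=
  M.length ≤ m ∧ ∀ c ∈ M, c.Valid P

/-- The `k`-neighbourhood of `s`: the vertices, as points of the plane, that can be reached
from `s` along at most `k` edges. -/
def kNeighborhood {P : Finset Plane} (G : SimpleGraph P) (k : ℕ) (s : P) : Set Plane :=
  {q | ∃ v : P, (v : Plane) = q ∧ ∃ p : G.Walk s v, p.length ≤ k}

/-- A deterministic local routing algorithm. From the current vertex `s`, the destination `t`,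
the neighbourhood of `s`, the extra information stored at `s` and the memory carried by the
message, it computes the vertex to which the message is forwarded and the new memory. It knows
nothing else about the graph. -/
structure RoutingAlgorithm : Type where
  next : (s t : Plane) → (nbhd : Set Plane) → (info mem : List MemCell) → Plane × List MemCell

/-- `A.Route G k m info t s M L`: in the graph `G`, with `k`-neighbourhoods known and `info v`
stored at each vertex `v`, a message for `t` that is at `s` with memory contents `M` is routed
by `A` along edges of `G` to `t`, it never carries more than `m` units of memory, and it
travels the total distance `L`. -/
inductive RoutingAlgorithm.Route (A : RoutingAlgorithm) {P : Finset Plane}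
    (G : SimpleGraph P) (k m : ℕ) (info : P → List MemCell) (t : P) :
    P → List MemCell → ℝ → Prop
  | arrived (M : List MemCell) : A.Route G k m info t t M 0
  | forward (s v : P) (M M' : List MemCell) (L : ℝ) :
      s ≠ t →
      A.next s t (kNeighborhood G k s) (info s) M = ((v : Plane), M') →
      G.Adj s v →
      FitsMemory P m M' →
      A.Route G k m info t v M' L →
      A.Route G k m info t s M (dist (s : Plane) v + L)

/-- `A`, started with empty memory, is a `k`-local `m`-memory routing algorithm on `G` that is
`d`-competitive for all sources `s` and destinations `t` that satisfy `R s t`: the message is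
delivered and travels at most `d` times the Euclidean distance of `s` and `t`. -/
def RoutingAlgorithm.IsCompetitive (A : RoutingAlgorithm) {P : Finset Plane}
    (G : SimpleGraph P) (k m : ℕ) (info : P → List MemCell)
    (R : Plane → Plane → Prop) (d : ℝ) : Prop :=
  ∀ s t : P, R s t →
    ∃ L : ℝ, A.Route G k m info t s [] L ∧ L ≤ d * dist (s : Plane) t

/-- `t` lies in a positive cone of `s`. -/
def InPosCone (s t : Plane) : Prop := ∃ i, t ∈ posCone i s

/-- `t` lies in a negative cone of `s`. -/
def InNegCone (s t : Plane) : Prop := ∃ i, t ∈ negCone i s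

end

/-!
In the hexagonal coordinates `hex 0`, `hex 1`, `hex 2` along the bisectors of the positive cones,
every cone is described by the order of two coordinates, and the neighbours of a vertex in one of
its negative cones form a chain on which these two coordinates vary in opposite directions.

In the half-θ₆-graph a message for `t` in a positive cone follows the edge in that cone. For `t` in
the negative cone `C̄ i` of `s` it takes an edge into the parallelogram with opposite corners `s`
and `t` if there is one; otherwise one of the two triangles beside the parallelogram contains a
vertex, and the message moves along this side. Its potential counts the advance `hex i s - hex i t`
once or twice, depending on whether the other side is occupied, and always following the side of
smaller potential never leads to an unoccupied side. Each edge lowers the potential by at least its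
own advance along the bisector of its cone.

An edge from `v` to the closest vertex `u` in `C i` need not be present in `G9` and `G12`, but both
contain the path from `v` through the consecutive neighbours of `u` in `C̄ i` to the closest one and
from there to `u`. Its length is at most `3 * (hex i u - hex i v)`, so the message travels at most
three times its potential.
-/

noncomputable section

/-! ### Hexagonal coordinates -/

/-- The `i`-th hexagonal coordinate: the signed length of the projection on the bisector of the
positive cone `C i`, scaled so that the unit vectors on the cone boundaries have coordinates
`-1`, `0` and `1`. The three coordinates of a vector add up to `0`. -/
def hex (i : Fin 3) : Plane →L[ℝ] ℝ :=
  (2 / √3) • innerSL ℝ (dir ((2 * posIndex i + 1) * (Real.pi / 6)))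

/-- The indices `i`, `j`, `k` of the three hexagonal coordinates in some order. Statements about
the cones with index `i` are made for all such `j`, `k`, which provides their mirror images. -/
def Distinct (i j k : Fin 3) : Prop := i ≠ j ∧ i ≠ k ∧ j ≠ k

lemma distinct_add (i : Fin 3) : Distinct i (i + 1) (i + 2) := by
  revert i
  unfold Distinct
  decide

namespace Distinct

variable {i j k : Fin 3}

lemma swap (h : Distinct i j k) : Distinct i k j := ⟨h.2.1, h.1, h.2.2.symm⟩

lemma rotate (h : Distinct i j k) : Distinct j k i := ⟨h.2.2, h.1.symm, h.2.1.symm⟩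

lemma eq_add_or_eq_add (h : Distinct i j k) :
    (j = i + 1 ∧ k = i + 2) ∨ (j = i + 2 ∧ k = i + 1) := by
  revert i j k
  unfold Distinct
  decide

lemma add_add_eq_sum {M : Type*} [AddCommMonoid M] (h : Distinct i j k) (f : Fin 3 → M) :
    f i + f j + f k = ∑ l, f l := by
  have huniv : ∀ i j k, Distinct i j k → Finset.univ = {i, j, k} := by
    unfold Distinct
    decide
  rw [huniv i j k h, Finset.sum_insert (by simp [h.1, h.2.1]), Finset.sum_pair h.2.2, add_assoc]

end Distinct

lemma dir_add_pi (θ : ℝ) : dir (θ + Real.pi) = -dir θ := by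
  ext l
  fin_cases l <;> simp [dir]

lemma ray_add_three (k : ℕ) : ray (k + 3) = -ray k := by
  rw [ray, ray, ← dir_add_pi]
  congr 1
  push_cast
  ring

lemma bisectorProj_add_three (k : ℕ) (u v : Plane) :
    bisectorProj (k + 3) u v = bisectorProj k v u := by
  have hangle : (2 * ((k + 3 : ℕ) : ℝ) + 1) * (Real.pi / 6) =
      (2 * k + 1) * (Real.pi / 6) + Real.pi := by
    push_cast
    ring
  rw [bisectorProj, bisectorProj, hangle, dir_add_pi, inner_neg_left, ← inner_neg_right, neg_sub]

lemma sector_add_three (k : ℕ) (u v : Plane) : v ∈ sector (k + 3) u ↔ u ∈ sector k v := by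
  simp only [sector, Set.mem_ofPred_eq, ray_add_three]
  constructor <;> rintro ⟨a, b, ha, hb, h⟩ <;> exact ⟨a, b, ha, hb, by rw [h]; module⟩

lemma mem_negCone_iff {i : Fin 3} {u v : Plane} : v ∈ negCone i u ↔ u ∈ posCone i v :=
  sector_add_three (posIndex i) u v

lemma bisectorProj_posIndex (i : Fin 3) (u v : Plane) :
    bisectorProj (posIndex i) u v = √3 / 2 * (hex i v - hex i u) := by
  rw [← map_sub, hex, smul_apply, smul_eq_mul, innerSL_apply_apply,
    bisectorProj]
  field_simp

lemma bisectorProj_negIndex (i : Fin 3) (u v : Plane) :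
    bisectorProj (negIndex i) u v = √3 / 2 * (hex i u - hex i v) :=
  (bisectorProj_add_three (posIndex i) u v).trans (bisectorProj_posIndex i v u)

lemma hex_apply (i : Fin 3) (v : Plane) :
    hex i v = 2 / √3 * (Real.cos ((2 * posIndex i + 1) * (Real.pi / 6)) * v 0 +
      Real.sin ((2 * posIndex i + 1) * (Real.pi / 6)) * v 1) := by
  simp [hex, dir, PiLp.inner_apply, Fin.sum_univ_two, mul_comm]

lemma hex_zero (v : Plane) : hex 0 v = 2 / √3 * v 1 := by
  have hangle : (2 * (posIndex 0 : ℕ) + 1) * (Real.pi / 6) = Real.pi / 2 := by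
    rw [show posIndex 0 = 1 from rfl]
    push_cast
    ring
  rw [hex_apply, hangle]
  simp

lemma hex_one (v : Plane) : hex 1 v = -v 0 - v 1 / √3 := by
  have hangle : (2 * (posIndex 1 : ℕ) + 1) * (Real.pi / 6) = Real.pi / 6 + Real.pi := by
    rw [show posIndex 1 = 3 from rfl]
    push_cast
    ring
  rw [hex_apply, hangle, Real.cos_add_pi, Real.sin_add_pi, Real.cos_pi_div_six,
    Real.sin_pi_div_six]
  field_simp
  ring

lemma hex_two (v : Plane) : hex 2 v = v 0 - v 1 / √3 := by
  have hangle : (2 * (posIndex 2 : ℕ) + 1) * (Real.pi / 6) = 2 * Real.pi - Real.pi / 6 := by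
    rw [show posIndex 2 = 5 from rfl]
    push_cast
    ring
  rw [hex_apply, hangle, Real.cos_two_pi_sub, Real.sin_two_pi_sub, Real.cos_pi_div_six,
    Real.sin_pi_div_six]
  field_simp
  ring

lemma sum_hex (v : Plane) : ∑ i, hex i v = 0 := by
  rw [Fin.sum_univ_three, hex_zero, hex_one, hex_two]
  ring

lemma sum_hex_sq (v : Plane) : ∑ i, hex i v ^ 2 = 2 * ‖v‖ ^ 2 := by
  rw [Fin.sum_univ_three, hex_zero, hex_one, hex_two, EuclideanSpace.norm_sq_eq,
    Fin.sum_univ_two, Real.norm_eq_abs, Real.norm_eq_abs, sq_abs, sq_abs]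
  have hsq : √3 ^ 2 = 3 := Real.sq_sqrt (by norm_num)
  field_simp
  linear_combination (-2 * v 1 ^ 2) * hsq

lemma ray_zero : ray 0 = !₂[1, 0] := by
  simp [ray, dir]

lemma ray_one : ray 1 = !₂[1 / 2, √3 / 2] := by
  simp [ray, dir]

lemma ray_two : ray 2 = !₂[-(1 / 2), √3 / 2] := by
  have hangle : ((2 : ℕ) : ℝ) * (Real.pi / 3) = Real.pi - Real.pi / 3 := by
    push_cast
    ring
  rw [ray, hangle, dir, Real.cos_pi_sub, Real.sin_pi_sub, Real.cos_pi_div_three,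
    Real.sin_pi_div_three]

lemma hex_ray_posIndex (i : Fin 3) :
    hex (i + 1) (ray (posIndex i)) = -1 ∧ hex (i + 2) (ray (posIndex i)) = 0 := by
  fin_cases i <;>
    simp [posIndex, hex_zero, hex_one, hex_two, ray_add_three 0, ray_add_three 2, ray_zero,
      ray_one, ray_two] <;>
    field_simp <;>
    norm_num

lemma hex_ray_posIndex_add_one (i : Fin 3) :
    hex (i + 1) (ray (posIndex i + 1)) = 0 ∧ hex (i + 2) (ray (posIndex i + 1)) = -1 := by
  fin_cases i <;>
    simp [posIndex, hex_zero, hex_one, hex_two, ray_add_three 0, ray_add_three 1,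
      ray_add_three 3, ray_zero, ray_one, ray_two] <;>
    field_simp <;>
    norm_num

namespace Distinct

variable {i j k : Fin 3} (h : Distinct i j k)

include h

lemma hex_add_add (v : Plane) : hex i v + hex j v + hex k v = 0 :=
  (h.add_add_eq_sum fun l => hex l v).trans (sum_hex v)

lemma hex_ext {v w : Plane} (hj : hex j v = hex j w) (hk : hex k v = hex k w) : v = w := by
  have hi : hex i v = hex i w := by linarith [h.hex_add_add v, h.hex_add_add w]
  have hnorm := (h.add_add_eq_sum fun l => hex l (v - w) ^ 2).trans (sum_hex_sq (v - w))
  simp only [map_sub, hi, hj, hk, sub_self] at hnorm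
  rw [← sub_eq_zero, ← norm_eq_zero, ← sq_eq_zero_iff]
  linarith

lemma dist_sq (v w : Plane) :
    dist v w ^ 2 = (hex j v - hex j w) ^ 2 + (hex j v - hex j w) * (hex k v - hex k w) +
      (hex k v - hex k w) ^ 2 := by
  have hnorm := (h.add_add_eq_sum fun l => hex l (v - w) ^ 2).trans (sum_hex_sq (v - w))
  have hi : hex i (v - w) = -hex j (v - w) - hex k (v - w) := by linarith [h.hex_add_add (v - w)]
  rw [dist_eq_norm, ← map_sub, ← map_sub]
  rw [hi] at hnorm
  linarith

lemma mem_posCone_iff {u v : Plane} : v ∈ posCone i u ↔ hex j v < hex j u ∧ hex k v < hex k u := by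
  have hadd : v ∈ posCone i u ↔ hex (i + 1) v < hex (i + 1) u ∧ hex (i + 2) v < hex (i + 2) u := by
    obtain ⟨hr1, hr2⟩ := hex_ray_posIndex i
    obtain ⟨hs1, hs2⟩ := hex_ray_posIndex_add_one i
    constructor
    · rintro ⟨a, b, ha, hb, rfl⟩
      simp only [map_add, map_smul, smul_eq_mul, hr1, hr2, hs1, hs2]
      constructor <;> linarith
    · rintro ⟨h1, h2⟩
      refine ⟨hex (i + 1) u - hex (i + 1) v, hex (i + 2) u - hex (i + 2) v, by linarith,
        by linarith, (distinct_add i).hex_ext ?_ ?_⟩ <;>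
      · simp only [map_add, map_smul, smul_eq_mul, hr1, hr2, hs1, hs2]
        ring
  rcases h.eq_add_or_eq_add with ⟨rfl, rfl⟩ | ⟨rfl, rfl⟩
  · exact hadd
  · exact hadd.trans and_comm

end Distinct

lemma clockwiseLT_iff (i : Fin 3) (u v w : Plane) :
    ClockwiseLT u v w ↔
      hex (i + 1) (v - u) * hex (i + 2) (w - u) < hex (i + 2) (v - u) * hex (i + 1) (w - u) := by
  have hcross : √3 / 2 * (hex (i + 1) (v - u) * hex (i + 2) (w - u) -
      hex (i + 2) (v - u) * hex (i + 1) (w - u)) =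
      (v - u) 0 * (w - u) 1 - (v - u) 1 * (w - u) 0 := by
    fin_cases i <;>
      simp [hex_zero, hex_one, hex_two] <;>
      field_simp <;>
      ring
  rw [ClockwiseLT, ← hcross, ← smul_eq_mul, smul_neg_iff_of_pos_left (by positivity), sub_neg]

/-- The `ℓ¹` distance in the hexagonal coordinates `j` and `k`. -/
def hexDist (j k : Fin 3) (v w : Plane) : ℝ := |hex j v - hex j w| + |hex k v - hex k w|

lemma hexDist_comm (j k : Fin 3) (v w : Plane) : hexDist j k v w = hexDist j k w v := by
  rw [hexDist, hexDist, abs_sub_comm, abs_sub_comm (hex k v)]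

lemma Distinct.dist_le_hexDist {i j k : Fin 3} (h : Distinct i j k) (v w : Plane) :
    dist v w ≤ hexDist j k v w := by
  refine abs_le_of_sq_le_sq ?_ (by unfold hexDist; positivity) |>.trans' (le_abs_self _)
  rw [h.dist_sq, hexDist, add_sq, sq_abs, sq_abs]
  have hmul := le_abs_self ((hex j v - hex j w) * (hex k v - hex k w))
  rw [abs_mul] at hmul
  have := mul_nonneg (abs_nonneg (hex j v - hex j w)) (abs_nonneg (hex k v - hex k w))
  linarith

variable {P : Finset Plane}

namespace GeneralPosition

variable (hP : GeneralPosition P)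

include hP

lemma hex_ne (i : Fin 3) {u v : P} (hne : u ≠ v) : hex i u ≠ hex i v := by
  obtain ⟨l, rfl⟩ : ∃ l, i = l + 2 := ⟨i - 2, (sub_add_cancel i 2).symm⟩
  obtain ⟨hr1, hr2⟩ := hex_ray_posIndex l
  intro heq
  refine hP u u.2 v v.2 (fun h => hne (Subtype.ext h)) (posIndex l)
    (hex (l + 1) u - hex (l + 1) v) ((distinct_add l).hex_ext ?_ ?_) <;>
  · simp only [map_sub, map_smul, smul_eq_mul, hr1, hr2, heq]
    ring

lemma hex_lt {i : Fin 3} {u v : P} (hne : u ≠ v) (hle : hex i u ≤ hex i v) :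
    hex i u < hex i v :=
  lt_of_le_of_ne hle (hP.hex_ne i hne)

end GeneralPosition

/-! ### Neighbours in the negative cones -/

lemma isClosestPos_iff {i : Fin 3} {u v : P} :
    IsClosestPos P i u v ↔
      (v : Plane) ∈ posCone i u ∧ ∀ w : P, (w : Plane) ∈ posCone i u → hex i v ≤ hex i w := by
  have hpos : 0 < √3 / 2 := by positivity
  simp only [IsClosestPos, bisectorProj_posIndex, mul_le_mul_iff_right₀ hpos,
    sub_le_sub_iff_right]

lemma exists_isClosestPos {i : Fin 3} {u v : P} (h : (v : Plane) ∈ posCone i u) :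
    ∃ w, IsClosestPos P i u w := by
  obtain ⟨w, hw, hmin⟩ := Set.exists_min_image {w : P | (w : Plane) ∈ posCone i u}
    (fun w => hex i w) (Set.toFinite _) ⟨v, h⟩
  exact ⟨w, isClosestPos_iff.2 ⟨hw, hmin⟩⟩

lemma GeneralPosition.isClosestPos_unique (hP : GeneralPosition P) {i : Fin 3} {u v w : P}
    (hv : IsClosestPos P i u v) (hw : IsClosestPos P i u w) : v = w := by
  rw [isClosestPos_iff] at hv hw
  by_contra hne
  exact hP.hex_ne i hne (le_antisymm (hv.2 w hw.1) (hw.2 v hv.1))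

/-- Some vertex in the cone `C k` of `s` precedes `t` in the direction of the bisector of `C k`.
If `t` lies in the negative cone `C̄ i` of `s`, this vertex lies in the part of `C k` that belongs
to the triangle with a corner at `t` that is cut off by a boundary line of the cone through `s`. -/
def SideOccupied (k : Fin 3) (s t : P) : Prop :=
  ∃ z : P, (z : Plane) ∈ posCone k s ∧ hex k z < hex k t

/-- Some neighbour of `s` in the negative cone `C̄ i` lies in the parallelogram that has opposite
corners `s` and `t` and whose sides are parallel to the boundary of `C̄ i`. -/
def HasNbrInParallelogram (i j k : Fin 3) (s t : P) : Prop :=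
  ∃ z, IsClosestPos P i z s ∧ hex j z ≤ hex j t ∧ hex k z ≤ hex k t

/-- `w` is the neighbour of `u` in the negative cone `C̄ i` that follows `v` in the direction of
increasing `hex k`. This is the clockwise order for `k = i + 1` and the counter-clockwise order
for `k = i + 2`. -/
def IsNextNeg (P : Finset Plane) (i k : Fin 3) (u v w : P) : Prop :=
  IsClosestPos P i v u ∧ IsClosestPos P i w u ∧ hex k v < hex k w ∧
    ∀ x, IsClosestPos P i x u → hex k v < hex k x → hex k w ≤ hex k x

/-- `c` is the neighbour of `u` in the negative cone `C̄ i` for which `hex k` is largest. This is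
the last one in clockwise order for `k = i + 1`, the first one for `k = i + 2` and the closest one
for `k = i`. -/
def IsExtremeNeg (P : Finset Plane) (i k : Fin 3) (u c : P) : Prop :=
  IsClosestPos P i c u ∧ ∀ x, IsClosestPos P i x u → hex k x ≤ hex k c

lemma SideOccupied.mono {k : Fin 3} {s t t' : P} (h : SideOccupied k s t)
    (hle : hex k t ≤ hex k t') : SideOccupied k s t' := by
  obtain ⟨z, hz, hzt⟩ := h
  exact ⟨z, hz, hzt.trans_le hle⟩

namespace Distinct

variable {i j k : Fin 3} (h : Distinct i j k)

include h

lemma hex_le_of_isClosestPos {u v w : P} (hv : IsClosestPos P i v u) (hj : hex j w < hex j v)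
    (hk : hex k w < hex k v) : hex i u ≤ hex i w :=
  (isClosestPos_iff.1 hv).2 w (h.mem_posCone_iff.2 ⟨hj, hk⟩)

lemma not_sideOccupied_of_isClosestPos {s t v : P} (hv : IsClosestPos P i v s)
    (hle : hex j t ≤ hex j v) : ¬ SideOccupied j s t := by
  rintro ⟨z, hz, hzt⟩
  have hzs := h.rotate.mem_posCone_iff.1 hz
  have hvs := h.mem_posCone_iff.1 hv.1
  have := h.hex_le_of_isClosestPos hv (w := z) (by linarith) (by linarith)
  linarith

lemma hex_lt_of_hex_lt (hP : GeneralPosition P) {u v w : P} (hv : IsClosestPos P i v u)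
    (hw : IsClosestPos P i w u) (hlt : hex k v < hex k w) : hex j w < hex j v := by
  by_contra! hle
  have hj := hP.hex_lt (ne_of_apply_ne (fun x : P => hex k x) hlt.ne) hle
  have huv := h.hex_le_of_isClosestPos hw hj hlt
  have hvu := h.mem_posCone_iff.1 hv.1
  linarith [h.hex_add_add u, h.hex_add_add v]

lemma hex_lt_hex_iff (hP : GeneralPosition P) {u v w : P} (hv : IsClosestPos P i v u)
    (hw : IsClosestPos P i w u) : hex k v < hex k w ↔ hex j w < hex j v :=
  ⟨h.hex_lt_of_hex_lt hP hv hw, h.swap.hex_lt_of_hex_lt hP hw hv⟩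

lemma hex_le_hex_iff (hP : GeneralPosition P) {u v w : P} (hv : IsClosestPos P i v u)
    (hw : IsClosestPos P i w u) : hex k v ≤ hex k w ↔ hex j w ≤ hex j v := by
  simpa only [not_lt] using (h.hex_lt_hex_iff hP hw hv).not

/-- The vertex in the parallelogram that is the first one in the direction of `C i` is joined to
`s`: a vertex that prevents this would occupy a side. -/
lemma hasNbrInParallelogram_of_not_sideOccupied (hP : GeneralPosition P) {s t : P}
    (ht : (s : Plane) ∈ posCone i t) (hj : ¬ SideOccupied j s t) (hk : ¬ SideOccupied k s t) :
    HasNbrInParallelogram i j k s t := by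
  obtain ⟨z, ⟨hzs, hzj, hzk⟩, hmax⟩ := Set.exists_max_image
    {z : P | (s : Plane) ∈ posCone i z ∧ hex j z ≤ hex j t ∧ hex k z ≤ hex k t}
    (fun z => hex i z) (Set.toFinite _) ⟨t, ht, le_rfl, le_rfl⟩
  refine ⟨z, isClosestPos_iff.2 ⟨hzs, fun w hw => ?_⟩, hzj, hzk⟩
  by_contra! hwi
  have hws : s ≠ w := ne_of_apply_ne (fun x : P => hex i x) hwi.ne'
  rw [h.mem_posCone_iff] at hw
  have hwj : hex j s < hex j w := by
    refine hP.hex_lt hws (not_lt.1 fun hlt => hk ⟨w, ?_, by linarith⟩)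
    exact h.rotate.rotate.mem_posCone_iff.2 ⟨hwi, hlt⟩
  have hwk : hex k s < hex k w := by
    refine hP.hex_lt hws (not_lt.1 fun hlt => hj ⟨w, ?_, by linarith⟩)
    exact h.rotate.mem_posCone_iff.2 ⟨hlt, hwi⟩
  have := hmax w ⟨h.mem_posCone_iff.2 ⟨hwj, hwk⟩, by linarith, by linarith⟩
  linarith [h.hex_add_add z, h.hex_add_add w]

/-- The triangle spanned by a vertex and two consecutive neighbours in a negative cone is empty. -/
lemma hex_le_of_isNextNeg (hP : GeneralPosition P) {s x y z : P} (hxy : IsNextNeg P i k s x y)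
    (hj : hex j z < hex j x) (hk : hex k z < hex k y) : hex i s ≤ hex i z := by
  obtain ⟨hx, hy, -, hnext⟩ := hxy
  by_contra! hzi
  have hsz : s ≠ z := ne_of_apply_ne (fun x : P => hex i x) hzi.ne'
  have hxs := h.mem_posCone_iff.1 hx.1
  have hys := h.mem_posCone_iff.1 hy.1
  have hzj : hex j s < hex j z := by
    refine hP.hex_lt hsz (not_lt.1 fun hzs => hzi.not_ge ?_)
    exact h.hex_le_of_isClosestPos hy (by linarith) hk
  have hzk : hex k s < hex k z := by
    refine hP.hex_lt hsz (not_lt.1 fun hzs => hzi.not_ge ?_)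
    exact h.hex_le_of_isClosestPos hx hj (by linarith)
  obtain ⟨w, hw, hwj, hwk⟩ := h.hasNbrInParallelogram_of_not_sideOccupied hP
    (h.mem_posCone_iff.2 ⟨hzj, hzk⟩) (h.not_sideOccupied_of_isClosestPos hx hj.le)
    (h.swap.not_sideOccupied_of_isClosestPos hy hk.le)
  have := hnext w hw ((h.hex_lt_hex_iff hP hx hw).2 (by linarith))
  linarith

lemma hasNbrInParallelogram_of_isClosestPos (hP : GeneralPosition P) {s t a b : P}
    (ht : (s : Plane) ∈ posCone i t) (ha : IsClosestPos P i a s) (hb : IsClosestPos P i b s)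
    (haj : hex j a ≤ hex j t) (hbk : hex k b ≤ hex k t) : HasNbrInParallelogram i j k s t := by
  by_cases hak : hex k a ≤ hex k t
  · exact ⟨a, ha, haj, hak⟩
  by_cases hbj : hex j b ≤ hex j t
  · exact ⟨b, hb, hbj, hbk⟩
  exact h.hasNbrInParallelogram_of_not_sideOccupied hP ht
    (h.not_sideOccupied_of_isClosestPos hb (not_le.1 hbj).le)
    (h.swap.not_sideOccupied_of_isClosestPos ha (not_le.1 hak).le)

lemma not_sideOccupied_of_child (hP : GeneralPosition P) {s t v : P}
    (hk : ¬ SideOccupied k s t) (hv : IsClosestPos P i v s)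
    (hmax : ∀ x : P, IsClosestPos P i x s → hex k x ≤ hex k t → hex k x ≤ hex k v) :
    ¬ SideOccupied k v t := by
  rintro ⟨z, hz, hzt⟩
  obtain ⟨hzi, hzj⟩ := h.rotate.rotate.mem_posCone_iff.1 hz
  have hvs := h.mem_posCone_iff.1 hv.1
  have hzv : hex k v < hex k z := by linarith [h.hex_add_add z, h.hex_add_add v]
  have hsz : s ≠ z := by
    rintro rfl
    linarith
  have hjz : hex j s < hex j z := by
    refine hP.hex_lt hsz (not_lt.1 fun hlt => hk ⟨z, ?_, hzt⟩)
    refine h.rotate.rotate.mem_posCone_iff.2 ⟨?_, hlt⟩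
    linarith [h.hex_add_add v, h.hex_add_add s]
  obtain ⟨w, hw, hwj, hwk⟩ := h.hasNbrInParallelogram_of_not_sideOccupied hP
    (h.mem_posCone_iff.2 ⟨hjz, by linarith⟩) (h.not_sideOccupied_of_isClosestPos hv hzj.le)
    (fun hocc => hk (hocc.mono hzt.le))
  have hvw := (h.hex_lt_hex_iff hP hv hw).2 (by linarith)
  linarith [hmax w hw (by linarith)]

lemma not_sideOccupied_of_parent (hP : GeneralPosition P) {s t v : P}
    (hk : ¬ SideOccupied k s t) (hv : IsClosestPos P j s v) (hvt : hex j v < hex j t)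
    (hn : ¬ HasNbrInParallelogram i j k s t) : ¬ SideOccupied k v t := by
  rintro ⟨z, hz, hzt⟩
  obtain ⟨hzi, hzj⟩ := h.rotate.rotate.mem_posCone_iff.1 hz
  have hvs := h.rotate.mem_posCone_iff.1 hv.1
  have hsz : s ≠ z := by
    rintro rfl
    linarith
  have hjz : hex j s < hex j z := by
    refine hP.hex_lt hsz (not_lt.1 fun hlt => hk ⟨z, ?_, hzt⟩)
    exact h.rotate.rotate.mem_posCone_iff.2 ⟨by linarith, hlt⟩
  have hkz : hex k s < hex k z := by
    refine hP.hex_lt hsz (not_lt.1 fun hlt => ?_)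
    linarith [h.rotate.hex_le_of_isClosestPos hv hlt (by linarith)]
  obtain ⟨w, hw, hwj, hwk⟩ := h.hasNbrInParallelogram_of_not_sideOccupied hP
    (h.mem_posCone_iff.2 ⟨hjz, hkz⟩)
    (fun ⟨w, hw, hwz⟩ => by linarith [(isClosestPos_iff.1 hv).2 w hw])
    (fun hocc => hk (hocc.mono hzt.le))
  exact hn ⟨w, hw, by linarith, by linarith⟩

lemma not_sideOccupied_of_hex_le {s t v : P} (ht : hex k t ≤ hex k s)
    (hv : IsClosestPos P i s v) : ¬ SideOccupied k v t := by
  rintro ⟨z, hz, hzt⟩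
  have hzv := h.rotate.rotate.mem_posCone_iff.1 hz
  have hvs := h.mem_posCone_iff.1 hv.1
  linarith [h.hex_le_of_isClosestPos hv (w := z) (by linarith) (by linarith)]

end Distinct

/-! ### Edges of the subgraphs -/

section Edges

variable {i j k : Fin 3}

lemma hex_lt_of_mem_posCone {l : Fin 3} {u v : Plane} (h : v ∈ posCone i u) (hl : l ≠ i) :
    hex l v < hex l u := by
  have d := distinct_add i
  have hd : ∀ i l : Fin 3, l ≠ i → l = i + 1 ∨ l = i + 2 := by decide
  rcases hd i l hl with rfl | rfl
  · exact (d.mem_posCone_iff.1 h).1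
  · exact (d.mem_posCone_iff.1 h).2

lemma hex_lt_of_mem_posCone_self {u v : Plane} (h : v ∈ posCone i u) : hex i u < hex i v := by
  have d := distinct_add i
  linarith [d.mem_posCone_iff.1 h, d.hex_add_add u, d.hex_add_add v]

lemma posCone_index_unique {u v : Plane} (hi : v ∈ posCone i u) (hj : v ∈ posCone j u) :
    i = j := by
  by_contra hne
  exact lt_asymm (hex_lt_of_mem_posCone_self hi) (hex_lt_of_mem_posCone hj hne)

lemma not_mem_posCone_of_mem_posCone {u v : Plane} (h : v ∈ posCone i u) : u ∉ posCone j v := by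
  have hexists : ∀ i j : Fin 3, ∃ l, l ≠ i ∧ l ≠ j := by decide
  obtain ⟨l, hli, hlj⟩ := hexists i j
  exact fun hj => lt_asymm (hex_lt_of_mem_posCone h hli) (hex_lt_of_mem_posCone hj hlj)

lemma IsClosestPos.ne {u v : P} (h : IsClosestPos P i u v) : u ≠ v := by
  rintro rfl
  exact not_mem_posCone_of_mem_posCone h.1 h.1

lemma halfTheta6_adj_iff {u v : P} :
    (halfTheta6 P).Adj u v ↔ (∃ i, IsClosestPos P i u v) ∨ ∃ i, IsClosestPos P i v u := by
  rw [halfTheta6, SimpleGraph.fromRel_adj, and_iff_right_iff_imp]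
  rintro (⟨i, h⟩ | ⟨i, h⟩)
  · exact h.ne
  · exact h.ne.symm

lemma mem_negNbrs_iff {u v : P} : v ∈ negNbrs P i u ↔ IsClosestPos P i v u := by
  rw [negNbrs, Set.mem_ofPred_eq, halfTheta6_adj_iff, mem_negCone_iff]
  constructor
  · rintro ⟨⟨j, h⟩ | ⟨j, h⟩, hcone⟩
    · exact absurd hcone (not_mem_posCone_of_mem_posCone h.1)
    · rwa [posCone_index_unique hcone h.1]
  · exact fun h => ⟨.inr ⟨i, h⟩, h.1⟩

lemma isClosestNeg_iff {u c : P} : IsClosestNeg P i u c ↔ IsExtremeNeg P i i u c := by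
  have hpos : 0 < √3 / 2 := by positivity
  simp only [IsClosestNeg, IsExtremeNeg, mem_negNbrs_iff, bisectorProj_negIndex,
    mul_le_mul_iff_right₀ hpos, sub_le_sub_iff_left]

lemma clockwiseLT_iff_hex_lt (hP : GeneralPosition P) {u v w : P} (hv : IsClosestPos P i v u)
    (hw : IsClosestPos P i w u) : ClockwiseLT u v w ↔ hex (i + 1) v < hex (i + 1) w := by
  have h := distinct_add i
  have hvu := h.mem_posCone_iff.1 hv.1
  have hwu := h.mem_posCone_iff.1 hw.1
  simp only [clockwiseLT_iff i, map_sub]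
  constructor
  · intro hcross
    by_contra! hle
    have := (h.swap.hex_le_hex_iff hP hw hv).1 hle
    nlinarith [hwu.1, hwu.2]
  · intro hlt
    have := h.swap.hex_lt_of_hex_lt hP hv hw hlt
    nlinarith [hwu.1, hwu.2]

lemma IsClosestNeg.adj {u c : P} (h : IsClosestNeg P i u c) : (G9 P ⊓ G12 P).Adj u c := by
  have hc := (isClosestNeg_iff.1 h).1
  rw [SimpleGraph.inf_adj, G9, G12, SimpleGraph.fromRel_adj, SimpleGraph.fromRel_adj]
  exact ⟨⟨hc.ne.symm, .inl ⟨halfTheta6_adj_iff.2 (.inr ⟨i, hc⟩), .inl ⟨i, h⟩⟩⟩,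
    hc.ne.symm, .inl ⟨i, .inr (.inr h)⟩⟩

lemma Distinct.adj_of_isExtremeNeg (h : Distinct i j k) (hP : GeneralPosition P) {u c : P}
    (hc : IsExtremeNeg P i k u c) : (G12 P).Adj u c := by
  have d := distinct_add i
  obtain ⟨hcu, hmax⟩ := hc
  refine (SimpleGraph.fromRel_adj _ _ _).2 ⟨hcu.ne.symm, .inl ⟨i, ?_⟩⟩
  rcases h.eq_add_or_eq_add with ⟨rfl, rfl⟩ | ⟨rfl, rfl⟩
  · refine .inl ⟨mem_negNbrs_iff.2 hcu, fun w hw hne => ?_⟩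
    rw [mem_negNbrs_iff] at hw
    rw [clockwiseLT_iff_hex_lt hP hcu hw, ← d.hex_lt_hex_iff hP hw hcu]
    exact hP.hex_lt hne (hmax w hw)
  · refine .inr (.inl ⟨mem_negNbrs_iff.2 hcu, fun w hw hne => ?_⟩)
    rw [mem_negNbrs_iff] at hw
    rw [clockwiseLT_iff_hex_lt hP hw hcu]
    exact hP.hex_lt hne (hmax w hw)

lemma Distinct.isNextNeg_swap (h : Distinct i j k) (hP : GeneralPosition P) {u v w : P}
    (hn : IsNextNeg P i k u v w) : IsNextNeg P i j u w v := by
  obtain ⟨hv, hw, hlt, hnext⟩ := hn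
  refine ⟨hw, hv, h.hex_lt_of_hex_lt hP hv hw hlt, fun x hx hwx => ?_⟩
  by_contra! hxv
  have hvx := (h.hex_lt_hex_iff hP hv hx).2 hxv
  exact ((h.hex_lt_hex_iff hP hx hw).2 hwx).not_ge (hnext x hx hvx)

lemma Distinct.isExtremeNeg_of_isNextNeg (h : Distinct i j k) (hP : GeneralPosition P)
    {u x y : P} (hn : IsNextNeg P i k u x y) (hlt : hex i y < hex i x) :
    IsExtremeNeg P k i y x := by
  have ⟨hx, hy, hxy, _⟩ := hn
  have hxu := h.mem_posCone_iff.1 hx.1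
  have hyu := h.mem_posCone_iff.1 hy.1
  have hyx := h.hex_lt_of_hex_lt hP hx hy hxy
  have hcone := h.rotate.rotate
  have hxy' : IsClosestPos P k x y := by
    refine isClosestPos_iff.2 ⟨hcone.mem_posCone_iff.2 ⟨hlt, hyx⟩, fun w hw => ?_⟩
    by_contra! hwy
    have hwx := hcone.mem_posCone_iff.1 hw
    linarith [h.hex_le_of_isNextNeg hP hn hwx.2 hwy, h.hex_add_add x, h.hex_add_add u]
  refine ⟨hxy', fun w hw => ?_⟩
  by_contra! hxw
  have hyw := hcone.mem_posCone_iff.1 hw.1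
  have huw := h.hex_le_of_isNextNeg hP hn (hcone.swap.hex_lt_of_hex_lt hP hxy' hw hxw)
    (hex_lt_of_mem_posCone_self hw.1)
  have hne : u ≠ w := ne_of_apply_ne (fun x : P => hex j x) (by linarith)
  linarith [hcone.hex_le_of_isClosestPos hw (hP.hex_lt hne huw) (by linarith)]

lemma Distinct.adj_of_isNextNeg (h : Distinct i j k) (hP : GeneralPosition P) {u x y : P}
    (hn : IsNextNeg P i k u x y) : (halfTheta6 P ⊓ G12 P).Adj x y := by
  have hne : x ≠ y := ne_of_apply_ne (fun x : P => hex k x) hn.2.2.1.ne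
  rcases lt_or_gt_of_ne (hP.hex_ne i hne) with hlt | hlt
  · have hext := h.swap.isExtremeNeg_of_isNextNeg hP (h.isNextNeg_swap hP hn) hlt
    exact ⟨halfTheta6_adj_iff.2 (.inr ⟨j, hext.1⟩), h.rotate.adj_of_isExtremeNeg hP hext⟩
  · have hext := h.isExtremeNeg_of_isNextNeg hP hn hlt
    exact ⟨halfTheta6_adj_iff.2 (.inl ⟨k, hext.1⟩),
      (h.rotate.rotate.swap.adj_of_isExtremeNeg hP hext).symm⟩

lemma isConsecutiveNeg_of_isNextNeg (hP : GeneralPosition P) {u v w : P}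
    (hn : IsNextNeg P i (i + 1) u v w) : IsConsecutiveNeg P i u v w := by
  obtain ⟨hv, hw, hlt, hnext⟩ := hn
  refine ⟨mem_negNbrs_iff.2 hv, mem_negNbrs_iff.2 hw, (clockwiseLT_iff_hex_lt hP hv hw).2 hlt,
    fun x hx => ?_⟩
  rw [mem_negNbrs_iff] at hx
  rw [clockwiseLT_iff_hex_lt hP hv hx, clockwiseLT_iff_hex_lt hP hx hw]
  exact fun ⟨hvx, hxw⟩ => (hnext x hx hvx).not_gt hxw

lemma Distinct.adj_inf_of_isNextNeg (h : Distinct i j k) (hP : GeneralPosition P) {u x y : P}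
    (hn : IsNextNeg P i k u x y) : (G9 P ⊓ G12 P).Adj x y := by
  have d := distinct_add i
  obtain ⟨hadj, h12⟩ := h.adj_of_isNextNeg hP hn
  refine ⟨?_, h12⟩
  rcases h.eq_add_or_eq_add with ⟨rfl, rfl⟩ | ⟨rfl, rfl⟩
  · exact (SimpleGraph.fromRel_adj _ _ _).2 ⟨hadj.ne.symm, .inl ⟨hadj.symm, .inr
      ⟨i, u, isConsecutiveNeg_of_isNextNeg hP (d.isNextNeg_swap hP hn)⟩⟩⟩ |>.symm
  · exact (SimpleGraph.fromRel_adj _ _ _).2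
      ⟨hadj.ne, .inl ⟨hadj, .inr ⟨i, u, isConsecutiveNeg_of_isNextNeg hP hn⟩⟩⟩

end Edges

/-! ### The information stored at the vertices -/

/-- The names of the points stored at a vertex. -/
inductive Slot : Type
  | parent (i : Fin 3)
  | child (i k : Fin 3)
  | sibling (i k : Fin 3)
  | closestSibling (i : Fin 3)

/-- The relation of a vertex `v` to the vertex `w` stored at `v` under a given name: the closest
vertex in a positive cone, a first, last or closest neighbour in a negative cone, and, among the
neighbours that a vertex closest to `v` has in the negative cone containing `v`, those next to `v`
and the closest one. -/
def Slot.Rel (v w : P) : Slot → Prop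
  | .parent i => IsClosestPos P i v w
  | .child i k => IsExtremeNeg P i k v w
  | .sibling i k => ∃ u, IsNextNeg P i k u v w
  | .closestSibling i => ∃ u, IsClosestPos P i v u ∧ IsExtremeNeg P i i u w

open Classical in
/-- The vertex stored at `v` under the name `x`; it is `v` itself if there is none to store. -/
def storedVertex (v : P) (x : Slot) : P := if h : ∃ w, x.Rel v w then h.choose else v

/-- The points stored at `v`. -/
def storedPoint (v : P) (x : Slot) : Plane := storedVertex v x

section Stored

variable {i k : Fin 3}

lemma exists_isNextNeg {u v w : P} (hv : IsClosestPos P i v u) (hw : IsClosestPos P i w u)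
    (hlt : hex k v < hex k w) : ∃ x, IsNextNeg P i k u v x := by
  obtain ⟨x, ⟨hx, hvx⟩, hmin⟩ := Set.exists_min_image
    {x : P | IsClosestPos P i x u ∧ hex k v < hex k x} (fun x => hex k x) (Set.toFinite _)
    ⟨w, hw, hlt⟩
  exact ⟨x, hv, hx, hvx, fun y hy hvy => hmin y ⟨hy, hvy⟩⟩

lemma exists_isExtremeNeg (k : Fin 3) {u v : P} (hv : IsClosestPos P i v u) :
    ∃ c, IsExtremeNeg P i k u c :=
  Set.exists_max_image {x : P | IsClosestPos P i x u} (fun x => hex k x) (Set.toFinite _) ⟨v, hv⟩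

namespace GeneralPosition

variable (hP : GeneralPosition P)

include hP

lemma isExtremeNeg_unique {u c c' : P} (h : IsExtremeNeg P i k u c)
    (h' : IsExtremeNeg P i k u c') : c = c' := by
  by_contra hne
  exact hP.hex_ne k hne (le_antisymm (h'.2 c h.1) (h.2 c' h'.1))

lemma isNextNeg_unique {u v w w' : P} (h : IsNextNeg P i k u v w)
    (h' : IsNextNeg P i k u v w') : w = w' := by
  obtain ⟨-, hw, hvw, hmin⟩ := h
  obtain ⟨-, hw', hvw', hmin'⟩ := h'
  by_contra hne
  exact hP.hex_ne k hne (le_antisymm (hmin w' hw' hvw') (hmin' w hw hvw))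

lemma rel_unique {x : Slot} {v w w' : P} (h : x.Rel v w) (h' : x.Rel v w') : w = w' := by
  cases x with
  | parent i => exact hP.isClosestPos_unique h h'
  | child i k => exact hP.isExtremeNeg_unique h h'
  | sibling i k =>
    obtain ⟨u, hu⟩ := h
    obtain ⟨u', hu'⟩ := h'
    obtain rfl := hP.isClosestPos_unique hu.1 hu'.1
    exact hP.isNextNeg_unique hu hu'
  | closestSibling i =>
    obtain ⟨u, hu, hc⟩ := h
    obtain ⟨u', hu', hc'⟩ := h'
    obtain rfl := hP.isClosestPos_unique hu hu'
    exact hP.isExtremeNeg_unique hc hc'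

lemma storedPoint_eq {x : Slot} {v w : P} (h : x.Rel v w) : storedPoint v x = w := by
  have hexists : ∃ w, x.Rel v w := ⟨w, h⟩
  rw [storedPoint, storedVertex, dif_pos hexists, hP.rel_unique hexists.choose_spec h]

end GeneralPosition

lemma rel_storedVertex {x : Slot} {v : P} (h : storedPoint v x ≠ v) :
    x.Rel v (storedVertex v x) := by
  by_cases hexists : ∃ w, x.Rel v w
  · rw [storedVertex, dif_pos hexists]
    exact hexists.choose_spec
  · rw [storedPoint, storedVertex, dif_neg hexists] at h
    exact absurd rfl h

end Stored

/-- A list of all names. -/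
def slots : List Slot :=
  (List.finRange 3).flatMap fun i => [.parent i, .closestSibling i] ++
    (List.finRange 3).flatMap fun k => [.child i k, .sibling i k]

lemma mem_slots (x : Slot) : x ∈ slots := by
  cases x <;> simp [slots]

/-- The stored points as a list of memory contents. -/
def encodeInfo (I : Slot → Plane) : List MemCell := slots.map fun x => .pt (I x)

/-- The points that a list of memory contents stands for. -/
def decodeInfo : List MemCell → Slot → Plane := Function.invFun encodeInfo

lemma encodeInfo_injective : Function.Injective encodeInfo := fun _ _ h =>
  funext fun x => MemCell.pt.inj (List.map_inj_left.1 h x (mem_slots x))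

lemma decodeInfo_encodeInfo (I : Slot → Plane) : decodeInfo (encodeInfo I) = I :=
  Function.leftInverse_invFun encodeInfo_injective I

lemma fitsMemory_encodeInfo (v : P) : FitsMemory P 30 (encodeInfo (storedPoint v)) := by
  refine ⟨by simp [encodeInfo, slots, List.finRange], fun c hc => ?_⟩
  obtain ⟨x, -, rfl⟩ := List.mem_map.1 hc
  exact (storedVertex v x).2

/-! ### The routing algorithm -/

/-- What the message is doing: it is about to decide on an edge of the half-θ₆-graph, or it
follows the edge to the closest vertex in the positive cone `C i`, or it follows an edge into the
negative cone `C̄ i` with boundary coordinates `hex j` and `hex k`, namely the one whose endpoint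
has the largest coordinate `hex k` not beyond the destination. -/
inductive Mode : Type
  | decide
  | up (i : Fin 3)
  | down (i j k : Fin 3)

instance : Nonempty Mode := ⟨.decide⟩

/-- The number of a mode. -/
def Mode.code : Mode → ℕ
  | .decide => 0
  | .up i => i + 1
  | .down i j k => 9 * i + 3 * j + k + 4

lemma Mode.code_injective : Function.Injective Mode.code := by
  rintro (_ | i | ⟨i, j, k⟩) (_ | i' | ⟨i', j', k'⟩) h <;> simp only [Mode.code] at h <;>
    grind

lemma Mode.code_le (m : Mode) : m.code ≤ 30 := by
  cases m <;> simp only [Mode.code] <;> omega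

/-- A mode as memory contents. Its number is written in unary because a unit of memory is only
guaranteed to hold integers less than the number of vertices, which may be `1`. -/
def encodeMode (m : Mode) : List MemCell := List.replicate m.code (.int 0)

/-- The mode that memory contents stand for. -/
def decodeMode : List MemCell → Mode := Function.invFun encodeMode

lemma encodeMode_injective : Function.Injective encodeMode := fun m m' h =>
  Mode.code_injective <| by
    simpa only [encodeMode, List.length_replicate] using congrArg List.length h

lemma decodeMode_encodeMode (m : Mode) : decodeMode (encodeMode m) = m :=
  Function.leftInverse_invFun encodeMode_injective m

lemma fitsMemory_encodeMode (v : P) (m : Mode) : FitsMemory P 30 (encodeMode m) := by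
  refine ⟨List.length_replicate.trans_le m.code_le, fun c hc => ?_⟩
  rw [List.eq_of_mem_replicate hc]
  exact Finset.card_pos.2 ⟨v, v.2⟩

/-- The condition `SideOccupied k s t`, evaluated on the points `I` stored at `s`. -/
def SeesOccupied (I : Slot → Plane) (s t : Plane) (k : Fin 3) : Prop :=
  I (.parent k) ≠ s ∧ hex k (I (.parent k)) < hex k t

/-- The condition `HasNbrInParallelogram i j k s t`, evaluated on the points `I` stored at `s`. -/
def SeesNbr (I : Slot → Plane) (s t : Plane) (i j k : Fin 3) : Prop :=
  I (.child i k) ≠ s ∧ hex j (I (.child i k)) ≤ hex j t ∧ hex k (I (.child i j)) ≤ hex k t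

open Classical in
/-- One third of the distance within which the router delivers a message from `s` to `t`, where `t`
lies in the negative cone `C̄ i` of `s`, if it keeps to the side `j`; `occ k` says that the side `k`
is occupied. -/
def potential (occ : Fin 3 → Prop) (i j k : Fin 3) (s t : Plane) : ℝ :=
  (if occ k then 2 else 1) * (hex i s - hex i t) + (hex j t - hex j s)

open Classical in
/-- The step along the edge to the closest vertex in the positive cone `C i`, which leads through
the siblings of `s`. -/
def upStep (I : Slot → Plane) (s : Plane) (i : Fin 3) : Plane × Mode :=
  if s = I (.closestSibling i) then (I (.parent i), .decide)
  else if hex (i + 1) s < hex (i + 1) (I (.closestSibling i)) then (I (.sibling i (i + 1)), .up i)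
  else (I (.sibling i (i + 2)), .up i)

open Classical in
/-- The first step to a destination in the negative cone `C̄ i` along the side `j`. -/
def sideStep (I : Slot → Plane) (s t : Plane) (i j k : Fin 3) : Plane × Mode :=
  if SeesNbr I s t i j k then (I (.child i i), .down i j k) else upStep I s j

open Classical in
/-- The first step to a destination in the negative cone `C̄ i` along the better side. -/
def negStep (I : Slot → Plane) (s t : Plane) (i : Fin 3) : Plane × Mode :=
  if potential (SeesOccupied I s t) i (i + 1) (i + 2) s t ≤
      potential (SeesOccupied I s t) i (i + 2) (i + 1) s t then
    sideStep I s t i (i + 1) (i + 2)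
  else sideStep I s t i (i + 2) (i + 1)

open Classical in
/-- The first step along a newly chosen edge of the half-θ₆-graph. -/
def decideStep (I : Slot → Plane) (s t : Plane) : Plane × Mode :=
  if h : ∃ i, t ∈ posCone i s then upStep I s h.choose
  else if h : ∃ i, s ∈ posCone i t then negStep I s t h.choose
  else (s, .decide)

open Classical in
/-- The next step in each mode. -/
def step (I : Slot → Plane) (s t : Plane) : Mode → Plane × Mode
  | .decide => decideStep I s t
  | .up i => upStep I s i
  | .down i j k =>
    if hex k t < hex k s then (I (.sibling i j), .down i j k)
    else if I (.sibling i k) ≠ s ∧ hex k (I (.sibling i k)) ≤ hex k t then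
      (I (.sibling i k), .down i j k)
    else decideStep I s t

/-- The routing algorithm. -/
def router : RoutingAlgorithm where
  next s t _ info mem :=
    let (v, m) := step (decodeInfo info) s t (decodeMode mem)
    (v, encodeMode m)

section Router

variable {i j k : Fin 3} {I : Slot → Plane} {s t : Plane}

lemma decideStep_of_mem_posCone (h : t ∈ posCone i s) : decideStep I s t = upStep I s i := by
  have hexists : ∃ i, t ∈ posCone i s := ⟨i, h⟩
  rw [decideStep, dif_pos hexists, posCone_index_unique hexists.choose_spec h]

lemma decideStep_of_mem_negCone (h : s ∈ posCone i t) : decideStep I s t = negStep I s t i := by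
  have hexists : ∃ i, s ∈ posCone i t := ⟨i, h⟩
  have hno : ¬ ∃ j, t ∈ posCone j s := fun ⟨_, hj⟩ => not_mem_posCone_of_mem_posCone h hj
  rw [decideStep, dif_neg hno, dif_pos hexists, posCone_index_unique hexists.choose_spec h]

lemma Distinct.exists_negStep_eq_sideStep (h : Distinct i j k) :
    ∃ j' k', Distinct i j' k' ∧ negStep I s t i = sideStep I s t i j' k' ∧
      potential (SeesOccupied I s t) i j' k' s t ≤ potential (SeesOccupied I s t) i j k s t ∧
      potential (SeesOccupied I s t) i j' k' s t ≤ potential (SeesOccupied I s t) i k j s t := by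
  have d := distinct_add i
  rcases le_or_gt (potential (SeesOccupied I s t) i (i + 1) (i + 2) s t)
    (potential (SeesOccupied I s t) i (i + 2) (i + 1) s t) with hle | hlt
  · refine ⟨_, _, d, if_pos hle, ?_⟩
    rcases h.eq_add_or_eq_add with ⟨rfl, rfl⟩ | ⟨rfl, rfl⟩
    · exact ⟨le_rfl, hle⟩
    · exact ⟨hle, le_rfl⟩
  · refine ⟨_, _, d.swap, if_neg hlt.not_ge, ?_⟩
    rcases h.eq_add_or_eq_add with ⟨rfl, rfl⟩ | ⟨rfl, rfl⟩
    · exact ⟨hlt.le, le_rfl⟩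
    · exact ⟨le_rfl, hlt.le⟩

end Router

lemma RoutingAlgorithm.Route.nonneg {A : RoutingAlgorithm} {G : SimpleGraph P} {r m : ℕ}
    {info : P → List MemCell} {t s : P} {M : List MemCell} {L : ℝ}
    (h : A.Route G r m info t s M L) : 0 ≤ L := by
  induction h with
  | arrived => exact le_rfl
  | forward => positivity

/-- In `G`, with `r`-neighbourhoods known, the router brings a message for `t` from `s` in mode `m`
to `t` within the distance `B`. -/
def Reaches (G : SimpleGraph P) (r : ℕ) (t s : P) (m : Mode) (B : ℝ) : Prop :=
  ∃ L ≤ B, router.Route G r 30 (fun v => encodeInfo (storedPoint v)) t s (encodeMode m) L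

lemma router_next (s t : Plane) (nbhd : Set Plane) (I : Slot → Plane) (m : Mode) :
    router.next s t nbhd (encodeInfo I) (encodeMode m) =
      ((step I s t m).1, encodeMode (step I s t m).2) := by
  simp only [router, decodeInfo_encodeInfo, decodeMode_encodeMode]

namespace Reaches

variable {G : SimpleGraph P} {r : ℕ} {s t : P} {m : Mode} {B B' : ℝ}

lemma nonneg (h : Reaches G r t s m B) : 0 ≤ B := by
  obtain ⟨L, hL, hroute⟩ := h
  exact hroute.nonneg.trans hL

lemma mono (h : Reaches G r t s m B) (hB : B ≤ B') : Reaches G r t s m B' := by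
  obtain ⟨L, hL, hroute⟩ := h
  exact ⟨L, hL.trans hB, hroute⟩

lemma refl (t : P) (m : Mode) (hB : 0 ≤ B) : Reaches G r t t m B := ⟨0, hB, .arrived _⟩

lemma forward {v : P} {m' : Mode} (h : Reaches G r t v m' B) (hadj : G.Adj s v)
    (hstep : step (storedPoint s) s t m = ((v : Plane), m')) :
    Reaches G r t s m (B + dist (s : Plane) v) := by
  rcases eq_or_ne s t with rfl | hne
  · exact refl s m (add_nonneg h.nonneg dist_nonneg)
  · obtain ⟨L, hL, hroute⟩ := h
    refine ⟨dist (s : Plane) v + L, by linarith, .forward s v _ _ L hne ?_ hadj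
      (fitsMemory_encodeMode v m') hroute⟩
    rw [router_next, hstep]

lemma congr_mode {m' : Mode} (h : Reaches G r t s m B)
    (hstep : step (storedPoint s) s t m' = step (storedPoint s) s t m) :
    Reaches G r t s m' B := by
  obtain ⟨L, hL, hroute⟩ := h
  refine ⟨L, hL, ?_⟩
  cases hroute with
  | arrived => exact .arrived _
  | forward _ v _ M' L hne hnext hadj hfits hroute =>
    refine .forward s v _ M' L hne ?_ hadj hfits hroute
    rw [← hnext, router_next, router_next, hstep]

end Reaches

/-! ### Following an edge of the half-θ₆-graph -/

@[elab_as_elim]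
lemma finite_lt_induction {α β : Type*} [Finite α] [Preorder β] (f : α → β) {C : α → Prop} (x : α)
    (h : ∀ x, (∀ y, f y < f x → C y) → C x) : C x :=
  (Set.wellFoundedOn_range.1 (Set.finite_range f).wellFoundedOn).induction x h

section Routing

variable {i j k : Fin 3} {G : SimpleGraph P} {r : ℕ} {s t u v w : P} {m : Mode} {B : ℝ}

lemma seesOccupied_iff (hP : GeneralPosition P) :
    SeesOccupied (storedPoint s) s t k ↔ SideOccupied k s t := by
  constructor
  · rintro ⟨hne, hlt⟩
    exact ⟨_, (show IsClosestPos P k s _ from rel_storedVertex hne).1, hlt⟩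
  · rintro ⟨z, hz, hzt⟩
    obtain ⟨v, hv⟩ := exists_isClosestPos hz
    rw [SeesOccupied, hP.storedPoint_eq (x := .parent k) hv]
    exact ⟨fun heq => hv.ne (Subtype.ext heq.symm), ((isClosestPos_iff.1 hv).2 z hz).trans_lt hzt⟩

lemma step_down_eq_sibling (hP : GeneralPosition P) (hv : IsClosestPos P i v u)
    (hvt : hex k v ≤ hex k t) (hw : IsClosestPos P i w u) (hlt : hex k w < hex k v) :
    step (storedPoint w) w t (.down i j k) = (storedPoint w (.sibling i k), .down i j k) := by
  obtain ⟨x, hx⟩ := exists_isNextNeg hw hv hlt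
  have hxv := hx.2.2.2 v hv hlt
  rw [step, if_neg (hlt.trans_le hvt).not_gt, if_pos]
  rw [hP.storedPoint_eq (x := .sibling i k) ⟨u, hx⟩]
  exact ⟨fun heq => hx.2.2.1.ne (congrArg (hex k) heq.symm), hxv.trans hvt⟩

lemma step_down_eq_decide (hP : GeneralPosition P) (hv : IsClosestPos P i v u)
    (hvt : hex k v ≤ hex k t)
    (hmax : ∀ x : P, IsClosestPos P i x u → hex k x ≤ hex k t → hex k x ≤ hex k v) :
    step (storedPoint v) v t (.down i j k) = decideStep (storedPoint v) v t := by
  rw [step, if_neg hvt.not_gt, if_neg]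
  rintro ⟨hne, hle⟩
  obtain ⟨u', hvu', hx, hlt, -⟩ := rel_storedVertex hne
  obtain rfl := hP.isClosestPos_unique hv hvu'
  exact (hmax _ hx hle).not_gt hlt

namespace Distinct

variable (h : Distinct i j k)

include h

lemma seesNbr_iff (hP : GeneralPosition P) (ht : (s : Plane) ∈ posCone i t) :
    SeesNbr (storedPoint s) s t i j k ↔ HasNbrInParallelogram i j k s t := by
  constructor
  · rintro ⟨hne, hj, hk⟩
    have ha : IsExtremeNeg P i k s _ := rel_storedVertex hne
    obtain ⟨b, hb⟩ := exists_isExtremeNeg j ha.1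
    rw [hP.storedPoint_eq (x := .child i j) hb] at hk
    exact h.hasNbrInParallelogram_of_isClosestPos hP ht ha.1 hb.1 hj hk
  · rintro ⟨z, hz, hzj, hzk⟩
    obtain ⟨a, ha⟩ := exists_isExtremeNeg k hz
    obtain ⟨b, hb⟩ := exists_isExtremeNeg j hz
    rw [SeesNbr, hP.storedPoint_eq (x := .child i k) ha, hP.storedPoint_eq (x := .child i j) hb]
    exact ⟨fun heq => ha.1.ne (Subtype.ext heq),
      ((h.hex_le_hex_iff hP hz ha.1).1 (ha.2 z hz)).trans hzj,
      ((h.hex_le_hex_iff hP hb.1 hz).2 (hb.2 z hz)).trans hzk⟩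

lemma hexDist_of_mem_posCone {u v : Plane} (hu : u ∈ posCone i v) :
    hexDist j k v u = hex i u - hex i v := by
  have := h.mem_posCone_iff.1 hu
  rw [hexDist, abs_of_pos (by linarith), abs_of_pos (by linarith)]
  linarith [h.hex_add_add u, h.hex_add_add v]

lemma hexDist_of_hex_le (hP : GeneralPosition P) (hv : IsClosestPos P i v u)
    (hw : IsClosestPos P i w u) (hle : hex k v ≤ hex k w) :
    hexDist j k v w = hex j v - hex j w + (hex k w - hex k v) := by
  have := (h.hex_le_hex_iff hP hv hw).1 hle
  rw [hexDist, abs_of_nonneg (by linarith), abs_of_nonpos (by linarith), neg_sub]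

/-- Each of the two terms of `hexDist j k v w`, and also `hexDist j k w u`, is at most
`hex i u - hex i v`. -/
lemma hexDist_add_hexDist_le (hP : GeneralPosition P) (hv : IsClosestPos P i v u)
    (hc : IsExtremeNeg P i i u w) :
    hexDist j k v w + hexDist j k w u ≤ 3 * (hex i u - hex i v) := by
  have hvu := h.mem_posCone_iff.1 hv.1
  have hwu := h.mem_posCone_iff.1 hc.1.1
  have hmax := hc.2 v hv
  have := h.hex_add_add u
  have := h.hex_add_add v
  have := h.hex_add_add w
  rw [h.hexDist_of_mem_posCone hc.1.1]
  rcases le_total (hex k v) (hex k w) with hle | hle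
  · rw [h.hexDist_of_hex_le hP hv hc.1 hle]
    linarith
  · rw [hexDist_comm, h.hexDist_of_hex_le hP hc.1 hv hle]
    linarith

lemma reaches_of_siblings (hP : GeneralPosition P) (hG : G9 P ⊓ G12 P ≤ G)
    (hv : IsClosestPos P i v u) (hreach : Reaches G r t v m B)
    (hstep : ∀ x : P, IsClosestPos P i x u → hex k x < hex k v →
      step (storedPoint x) x t m = (storedPoint x (.sibling i k), m)) :
    ∀ x : P, IsClosestPos P i x u → hex k x ≤ hex k v →
      Reaches G r t x m (B + hexDist j k x v) := by
  intro x hx hle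
  induction x using finite_lt_induction (fun x : P => -hex k x) with | _ x ih
  rcases eq_or_ne x v with rfl | hne
  · exact hreach.mono (by simp [hexDist])
  have hlt := hP.hex_lt hne hle
  obtain ⟨y, hxy⟩ := exists_isNextNeg hx hv hlt
  have hyv := hxy.2.2.2 v hv hlt
  have hreach_y := (ih y (neg_lt_neg hxy.2.2.1) hxy.2.1 hyv).forward
    (hG (h.adj_inf_of_isNextNeg hP hxy))
    (by rw [hstep x hx hlt, hP.storedPoint_eq (x := .sibling i k) ⟨u, hxy⟩])
  refine hreach_y.mono ?_
  rw [h.hexDist_of_hex_le hP hx hv hle, h.hexDist_of_hex_le hP hxy.2.1 hv hyv]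
  have := h.dist_le_hexDist x y
  rw [h.hexDist_of_hex_le hP hx hxy.2.1 hxy.2.2.1.le] at this
  linarith

lemma upStep_eq_sibling (hP : GeneralPosition P) (hv : IsClosestPos P i v u)
    (hw : IsExtremeNeg P i i u w) (hlt : hex k v < hex k w) :
    upStep (storedPoint v) v i = (storedPoint v (.sibling i k), .up i) := by
  have hne : (v : Plane) ≠ w := fun heq => hlt.ne (congrArg (hex k) heq)
  have hjlt := h.hex_lt_of_hex_lt hP hv hw.1 hlt
  rw [upStep, hP.storedPoint_eq (x := .closestSibling i) ⟨u, hv, hw⟩, if_neg hne]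
  rcases h.eq_add_or_eq_add with ⟨rfl, rfl⟩ | ⟨rfl, rfl⟩
  · rw [if_neg hjlt.not_gt]
  · rw [if_pos hlt]

lemma reaches_up (hP : GeneralPosition P) (hG : G9 P ⊓ G12 P ≤ G) (hv : IsClosestPos P i v u)
    (hreach : Reaches G r t u .decide B) :
    Reaches G r t v (.up i) (B + 3 * (hex i u - hex i v)) := by
  obtain ⟨c, hc⟩ := exists_isExtremeNeg i hv
  have hreach_c : Reaches G r t c (.up i) (B + dist (c : Plane) u) := by
    refine hreach.forward (hG (isClosestNeg_iff.2 hc).adj.symm) ?_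
    rw [step, upStep, hP.storedPoint_eq (x := .closestSibling i) ⟨u, hc.1, hc⟩, if_pos rfl,
      hP.storedPoint_eq (x := .parent i) hc.1]
  have hreach_v : Reaches G r t v (.up i) (B + dist (c : Plane) u + hexDist j k v c) := by
    rcases le_total (hex k v) (hex k c) with hle | hle
    · exact h.reaches_of_siblings hP hG hc.1 hreach_c
        (fun x hx hlt => h.upStep_eq_sibling hP hx hc hlt) v hv hle
    · rw [hexDist, add_comm |hex j _ - _|]
      exact h.swap.reaches_of_siblings hP hG hc.1 hreach_c
        (fun x hx hlt => h.swap.upStep_eq_sibling hP hx hc hlt) v hv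
        ((h.hex_le_hex_iff hP hc.1 hv).1 hle)
  refine hreach_v.mono ?_
  linarith [h.hexDist_add_hexDist_le hP hv hc, h.dist_le_hexDist c u]

lemma reaches_down (hP : GeneralPosition P) (hG : G9 P ⊓ G12 P ≤ G) (hv : IsClosestPos P i v s)
    (hvt : hex k v ≤ hex k t)
    (hmax : ∀ x : P, IsClosestPos P i x s → hex k x ≤ hex k t → hex k x ≤ hex k v)
    (hstep : decideStep (storedPoint s) s t = (storedPoint s (.child i i), .down i j k))
    (hreach : Reaches G r t v .decide B) :
    Reaches G r t s .decide (B + 3 * (hex i s - hex i v)) := by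
  obtain ⟨c, hc⟩ := exists_isExtremeNeg i hv
  have hreach_v : Reaches G r t v (.down i j k) B :=
    hreach.congr_mode (step_down_eq_decide hP hv hvt hmax)
  have hreach_c : Reaches G r t c (.down i j k) (B + hexDist j k v c) := by
    rw [hexDist_comm]
    rcases le_total (hex k c) (hex k v) with hle | hle
    · exact h.reaches_of_siblings hP hG hv hreach_v
        (fun x hx hlt => step_down_eq_sibling hP hv hvt hx hlt) c hc.1 hle
    · rw [hexDist, add_comm |hex j _ - _|]
      refine h.swap.reaches_of_siblings hP hG hv hreach_v (fun x hx hlt => ?_) c hc.1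
        ((h.hex_le_hex_iff hP hv hc.1).1 hle)
      have hlt' := (h.hex_lt_hex_iff hP hv hx).2 hlt
      exact if_pos (not_le.1 fun hxt => (hmax x hx hxt).not_gt hlt')
  have hreach_s := hreach_c.forward (m := .decide) (hG (isClosestNeg_iff.2 hc).adj) (by
    rw [step, hstep, hP.storedPoint_eq (x := .child i i) hc])
  refine hreach_s.mono ?_
  linarith [h.hexDist_add_hexDist_le hP hv hc, h.dist_le_hexDist c s, dist_comm (c : Plane) s]

end Distinct

/-! ### Routing into a negative cone -/

lemma potential_add_le (hocc : ¬ SideOccupied k s t → ¬ SideOccupied k v t)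
    (hvt : hex i t ≤ hex i v) (hvs : hex i v ≤ hex i s) :
    potential (SideOccupied · v t) i j k v t + (hex i s - hex i v) + (hex j v - hex j s) ≤
      potential (SideOccupied · s t) i j k s t := by
  unfold potential
  split_ifs with hv hs
  · linarith
  · exact absurd hv (hocc hs)
  · linarith
  · linarith

namespace Distinct

variable (h : Distinct i j k)

include h

lemma occupied_of_potential_le {occ : Fin 3 → Prop} {s t : Plane} (hst : s ∈ posCone i t)
    (hle : potential occ i j k s t ≤ potential occ i k j s t) (hk : occ k) : occ j := by
  by_contra hj
  simp only [potential, if_pos hk, if_neg hj] at hle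
  linarith [h.mem_posCone_iff.1 hst, h.hex_add_add s, h.hex_add_add t]

lemma potential_le {occ : Fin 3 → Prop} {s t : Plane} (hst : s ∈ posCone i t) :
    potential occ i j k s t ≤ 3 * (hex j t - hex j s) + 2 * (hex k t - hex k s) := by
  have hst' := h.mem_posCone_iff.1 hst
  unfold potential
  split_ifs <;> linarith [h.hex_add_add s, h.hex_add_add t]

lemma reaches_of_hasNbr (hP : GeneralPosition P) (hG : G9 P ⊓ G12 P ≤ G)
    (hst : (s : Plane) ∈ posCone i t) (hn : HasNbrInParallelogram i j k s t)
    (hstep : decideStep (storedPoint s) s t = sideStep (storedPoint s) s t i j k)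
    (ih : ∀ v : P, hex i v < hex i s → hex j v ≤ hex j t → hex k v ≤ hex k t →
      Reaches G r t v .decide (3 * potential (SideOccupied · v t) i j k v t)) :
    Reaches G r t s .decide (3 * potential (SideOccupied · s t) i j k s t) := by
  rw [sideStep, if_pos ((h.seesNbr_iff hP hst).2 hn)] at hstep
  obtain ⟨z, hz, hzj, hzk⟩ := hn
  obtain ⟨v, ⟨hv, hvt⟩, hmax⟩ := Set.exists_max_image
    {x : P | IsClosestPos P i x s ∧ hex k x ≤ hex k t} (fun x => hex k x) (Set.toFinite _)
    ⟨z, hz, hzk⟩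
  have hvj : hex j v ≤ hex j t := ((h.hex_le_hex_iff hP hz hv).1 (hmax z ⟨hz, hzk⟩)).trans hzj
  have hvi := hex_lt_of_mem_posCone_self hv.1
  have hvs := h.mem_posCone_iff.1 hv.1
  have hmax' := fun x hx hxt => hmax x ⟨hx, hxt⟩
  refine (h.reaches_down hP hG hv hvt hmax' hstep (ih v hvi hvj hvt)).mono ?_
  have hpot := potential_add_le (j := j) (fun hk => h.not_sideOccupied_of_child hP hk hv hmax')
    (by linarith [h.hex_add_add v, h.hex_add_add t]) hvi.le
  linarith

lemma reaches_of_not_hasNbr (hP : GeneralPosition P) (hG : G9 P ⊓ G12 P ≤ G)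
    (hst : (s : Plane) ∈ posCone i t) (hn : ¬ HasNbrInParallelogram i j k s t)
    (hocc : SideOccupied j s t)
    (hstep : decideStep (storedPoint s) s t = sideStep (storedPoint s) s t i j k)
    (ih : ∀ v : P, hex i v < hex i s → hex j v ≤ hex j t → hex k v ≤ hex k t →
      Reaches G r t v .decide (3 * potential (SideOccupied · v t) i j k v t)) :
    Reaches G r t s .decide (3 * potential (SideOccupied · s t) i j k s t) := by
  rw [sideStep, if_neg (mt (h.seesNbr_iff hP hst).1 hn)] at hstep
  obtain ⟨z, hz, hzt⟩ := hocc
  obtain ⟨v, hv⟩ := exists_isClosestPos hz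
  have hvt : hex j v < hex j t := ((isClosestPos_iff.1 hv).2 z hz).trans_lt hzt
  have hvs := h.rotate.mem_posCone_iff.1 hv.1
  have hst' := h.mem_posCone_iff.1 hst
  have hreach := ih v hvs.2 hvt.le (by linarith)
  refine ((h.rotate.reaches_up hP hG hv hreach).congr_mode (m' := .decide) hstep).mono ?_
  have hpot := potential_add_le (j := j) (fun hk => h.not_sideOccupied_of_parent hP hk hv hvt hn)
    (by linarith [h.hex_add_add v, h.hex_add_add t]) hvs.2.le
  linarith

end Distinct

lemma reaches_negCone (hP : GeneralPosition P) (hG : G9 P ⊓ G12 P ≤ G) (h : Distinct i j k)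
    (hj : hex j s ≤ hex j t) (hk : hex k s ≤ hex k t) :
    Reaches G r t s .decide (3 * potential (SideOccupied · s t) i j k s t) := by
  induction s using finite_lt_induction (fun s : P => hex i s) generalizing j k with | _ s ih
  rcases eq_or_ne s t with rfl | hne
  · exact .refl s _ (by simp [potential])
  have hst : (s : Plane) ∈ posCone i t :=
    h.mem_posCone_iff.2 ⟨hP.hex_lt hne hj, hP.hex_lt hne hk⟩
  have hsees : SeesOccupied (storedPoint s) s t = (SideOccupied · s t) :=
    funext fun _ => propext (seesOccupied_iff hP)
  obtain ⟨j', k', h', hstep, hle, hle'⟩ :=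
    h.exists_negStep_eq_sideStep (I := storedPoint s) (s := s) (t := t)
  rw [hsees] at hle hle'
  have hmin : potential (SideOccupied · s t) i j' k' s t ≤
      potential (SideOccupied · s t) i k' j' s t := by
    rcases h.eq_add_or_eq_add with ⟨rfl, rfl⟩ | ⟨rfl, rfl⟩ <;>
    rcases h'.eq_add_or_eq_add with ⟨rfl, rfl⟩ | ⟨rfl, rfl⟩ <;> assumption
  refine Reaches.mono ?_ (mul_le_mul_of_nonneg_left hle (by norm_num))
  rw [← decideStep_of_mem_negCone hst] at hstep
  by_cases hn : HasNbrInParallelogram i j' k' s t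
  · exact h'.reaches_of_hasNbr hP hG hst hn hstep fun v hv => ih v hv h'
  · refine h'.reaches_of_not_hasNbr hP hG hst hn ?_ hstep fun v hv => ih v hv h'
    by_contra hj'
    have hk' : SideOccupied k' s t := by
      by_contra hk'
      exact hn (h'.hasNbrInParallelogram_of_not_sideOccupied hP hst hj' hk')
    exact hj' (h'.occupied_of_potential_le (occ := (SideOccupied · s t)) hst hmin hk')

/-! ### Routing into a positive cone -/

namespace Distinct

variable (h : Distinct i j k)

include h

/-- The edge from `s` to `v` passes `t` on the side `k`. Since the triangle of this edge is empty,
`t` is then reached from `v` along the other side of its cone. -/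
lemma reaches_of_hex_lt (hP : GeneralPosition P) (hG : G9 P ⊓ G12 P ≤ G)
    (hst : (t : Plane) ∈ posCone i s) (hv : IsClosestPos P i s v) (hlt : hex k v < hex k t) :
    Reaches G r t v .decide (3 * (hex i t - hex i v + (hex j v - hex j t))) := by
  have hvt := (isClosestPos_iff.1 hv).2 t hst
  have hfree := h.not_sideOccupied_of_hex_le (h.mem_posCone_iff.1 hst).2.le hv
  refine (reaches_negCone hP hG h.rotate.swap hvt hlt.le).mono ?_
  simp only [potential, if_neg hfree]
  linarith

lemma reaches_posCone (hP : GeneralPosition P) (hG : G9 P ⊓ G12 P ≤ G)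
    (hj : hex j t ≤ hex j s) (hk : hex k t ≤ hex k s) :
    Reaches G r t s .decide
      (3 * (hex i t - hex i s + max (hex j s - hex j t) (hex k s - hex k t))) := by
  induction s using finite_lt_induction (fun s : P => -hex i s) with | _ s ih
  rcases eq_or_ne s t with rfl | hne
  · exact .refl s _ (by simp)
  have hst : (t : Plane) ∈ posCone i s :=
    h.mem_posCone_iff.2 ⟨hP.hex_lt hne.symm hj, hP.hex_lt hne.symm hk⟩
  obtain ⟨v, hv⟩ := exists_isClosestPos hst
  have hvs := h.mem_posCone_iff.1 hv.1
  have hreach : Reaches G r t v .decide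
      (3 * (hex i t - hex i v + max (hex j s - hex j t) (hex k s - hex k t))) := by
    rcases lt_or_ge (hex k v) (hex k t) with hlt | hkv
    · refine (h.reaches_of_hex_lt hP hG hst hv hlt).mono ?_
      linarith [le_max_left (hex j s - hex j t) (hex k s - hex k t)]
    rcases lt_or_ge (hex j v) (hex j t) with hlt | hjv
    · refine (h.swap.reaches_of_hex_lt hP hG hst hv hlt).mono ?_
      linarith [le_max_right (hex j s - hex j t) (hex k s - hex k t)]
    · refine (ih v (neg_lt_neg (hex_lt_of_mem_posCone_self hv.1)) hjv hkv).mono ?_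
      gcongr
      · exact hvs.1.le
      · exact hvs.2.le
  refine ((h.reaches_up hP hG hv hreach).congr_mode (m' := .decide)
    (decideStep_of_mem_posCone hst)).mono ?_
  linarith

lemma reaches_posCone_dist (hP : GeneralPosition P) (hG : G9 P ⊓ G12 P ≤ G)
    (hst : (t : Plane) ∈ posCone i s) :
    Reaches G r t s .decide (6 * dist (s : Plane) t) := by
  have hst' := h.mem_posCone_iff.1 hst
  refine (h.reaches_posCone hP hG hst'.1.le hst'.2.le).mono ?_
  have hdist := h.dist_sq s t
  have hsum : hex i t - hex i s = (hex j s - hex j t) + (hex k s - hex k t) := by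
    linarith [h.hex_add_add s, h.hex_add_add t]
  have hbound : ∀ x y : ℝ, dist (s : Plane) t ^ 2 = x ^ 2 + x * y + y ^ 2 →
      x + y + x ≤ 2 * dist (s : Plane) t := fun x y hxy =>
    abs_le_of_sq_le_sq' (by nlinarith [sq_nonneg y]) (by positivity) |>.2
  rw [hsum]
  rcases max_cases (hex j s - hex j t) (hex k s - hex k t) with ⟨hmax, -⟩ | ⟨hmax, -⟩
  · linarith [hbound _ _ hdist]
  · linarith [hbound (hex k s - hex k t) (hex j s - hex j t) (by linarith)]

lemma reaches_negCone_dist (hP : GeneralPosition P) (hG : G9 P ⊓ G12 P ≤ G)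
    (hst : (s : Plane) ∈ posCone i t) :
    Reaches G r t s .decide (3 * (5 / √3) * dist (s : Plane) t) := by
  wlog hle : hex j t - hex j s ≤ hex k t - hex k s generalizing j k
  · exact this h.swap (le_of_not_ge hle)
  have hst' := h.mem_posCone_iff.1 hst
  refine (reaches_negCone hP hG h hst'.1.le hst'.2.le).mono ?_
  have hdist := h.dist_sq t s
  have hbound : 3 * (hex j t - hex j s) + 2 * (hex k t - hex k s) ≤
      5 / √3 * dist (s : Plane) t := by
    refine abs_le_of_sq_le_sq' ?_ (by positivity) |>.2
    rw [dist_comm, mul_pow, div_pow, Real.sq_sqrt (by norm_num), hdist]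
    nlinarith [mul_nonneg (sub_nonneg.2 hle) (sub_pos.2 hst'.1).le,
      mul_nonneg (sub_nonneg.2 hle) (sub_pos.2 hst'.2).le]
  have := (h.potential_le (occ := (SideOccupied · s t)) hst).trans hbound
  linarith

end Distinct

end Routing

theorem mainTheorem9_general :
    ∃ (m : ℕ) (A : RoutingAlgorithm), ∀ P : Finset Plane, GeneralPosition P →
      ∃ info : P → List MemCell, (∀ v, FitsMemory P m (info v)) ∧
        ∀ (G : SimpleGraph P) (r : ℕ), G9 P ⊓ G12 P ≤ G →
          A.IsCompetitive G r m info InPosCone 6 ∧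
          A.IsCompetitive G r m info InNegCone (3 * (5 / √3)) := by
  refine ⟨30, router, fun P hP => ⟨fun v => encodeInfo (storedPoint v), fitsMemory_encodeInfo,
    fun G r hG => ⟨?_, ?_⟩⟩⟩
  · rintro s t ⟨i, hst⟩
    obtain ⟨L, hL, hroute⟩ := (distinct_add i).reaches_posCone_dist (r := r) hP hG hst
    exact ⟨L, hroute, hL⟩
  · rintro s t ⟨i, hst⟩
    obtain ⟨L, hL, hroute⟩ :=
      (distinct_add i).reaches_negCone_dist (r := r) hP hG (mem_negCone_iff.1 hst)
    exact ⟨L, hroute, hL⟩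

end

theorem mainTheorem9 :
    ∃ (m : ℕ) (A : RoutingAlgorithm), ∀ P : Finset Plane, GeneralPosition P →
      ∃ info : P → List MemCell, (∀ v, FitsMemory P m (info v)) ∧
        ∀ G : SimpleGraph P, G = G9 P ∨ G = G12 P →
          A.IsCompetitive G 1 m info InPosCone 6 ∧
          A.IsCompetitive G 1 m info InNegCone (3 * (5 / Real.sqrt 3)) := by
  obtain ⟨m, A, hA⟩ := mainTheorem9_general
  refine ⟨m, A, fun P hP => (hA P hP).imp fun info hinfo => ⟨hinfo.1, fun G hG => ?_⟩⟩
  exact hinfo.2 G 1 (by rcases hG with rfl | rfl; exacts [inf_le_left, inf_le_right])
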